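/- Let $\mathcal H$ be a complex Hilbert space. For a bounded operator $A$ on $\mathcal H$ and $1\le p<\infty$ put $|A|=(A^*A)^{1/2}$ and $\|A\|_p=[\operatorname{Tr}|A|^p]^{1/p}\in[0,\infty]$, where the trace of a positive operator $T$ is $\operatorname{Tr}T=\sum_i\langle e_i,Te_i\rangle\in[0,\infty]$ for any orthonormal basis $(e_i)$ of $\mathcal H$. The operator $A$ is called trace class if $\operatorname{Tr}|A|<\infty$. A state is a positive trace class operator of trace $1$. Let $1<p<\infty$. (i) Let $A_0$ and $(A_n)_{n\ge 1}$ be trace class operators on $\mathcal H$, with $A_0$ normal and $\|A_0\|_1=\|A_n\|_1=1$ for all $n$. If $\|A_0-A_n\|_p\to 0$, then $\|A_0-A_n\|_1\to 0$. (ii) The topologies induced on the set of states by the norms $\|\cdot\|_1$ and $\|\cdot\|_p$ coincide. -/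

import Mathlib

open scoped ENNReal InnerProductSpace

noncomputable section

variable {H : Type*} [NormedAddCommGroup H] [InnerProductSpace ℂ H] [CompleteSpace H]

/-- The trace `∑ i, ⟪e i, T (e i)⟫`, with values in `[0, ∞]`, of a positive bounded operator `T`,
computed in a fixed orthonormal (Hilbert) basis `e` of `H`. By `posTrace_eq_tsum` below, the value
does not depend on the basis. It is only used for positive operators. -/
def posTrace (T : H →L[ℂ] H) : ℝ≥0∞ :=
  ∑' i, ENNReal.ofReal
    (⟪(exists_hilbertBasis ℂ H).choose_spec.choose i,
      T ((exists_hilbertBasis ℂ H).choose_spec.choose i)⟫_ℂ).re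

theorem HilbertBasis.tsum_enorm_inner_sq {ι : Type*} (b : HilbertBasis ι ℂ H) (x : H) :
    ∑' i, ENNReal.ofReal (‖⟪b i, x⟫_ℂ‖ ^ 2) = ENNReal.ofReal (‖x‖ ^ 2) := by
  have h := b.hasSum_inner_mul_inner x x
  have h2 : HasSum (fun i => ‖⟪b i, x⟫_ℂ‖ ^ 2) (‖x‖ ^ 2) := by
    have h3 := Complex.hasSum_re h
    have e1 : ∀ i, (⟪x, b i⟫_ℂ * ⟪b i, x⟫_ℂ).re = ‖⟪b i, x⟫_ℂ‖ ^ 2 := by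
      intro i
      rw [← inner_conj_symm x (b i), mul_comm, Complex.mul_conj, Complex.ofReal_re,
        Complex.normSq_eq_norm_sq]
    have e2 : (⟪x, x⟫_ℂ).re = ‖x‖ ^ 2 := by
      rw [inner_self_eq_norm_sq_to_K]; norm_cast
    simpa only [e1, e2] using h3
  rw [← h2.tsum_eq, ENNReal.ofReal_tsum_of_nonneg (fun _ => by positivity) h2.summable]

theorem posTrace_eq_tsum {ι : Type*} (b : HilbertBasis ι ℂ H) {T : H →L[ℂ] H}
    (hT : T.IsPositive) :
    posTrace T = ∑' i, ENNReal.ofReal (⟪b i, T (b i)⟫_ℂ).re := by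
  have hT0 : 0 ≤ T := (ContinuousLinearMap.nonneg_iff_isPositive T).2 hT
  set S := CFC.sqrt T with hS
  have hSS : S * S = T := CFC.sqrt_mul_sqrt_self T hT0
  have hSsa : IsSelfAdjoint S := (CFC.sqrt_nonneg T).isSelfAdjoint
  have sym : ∀ x y, ⟪S x, y⟫_ℂ = ⟪x, S y⟫_ℂ := fun x y =>
    (ContinuousLinearMap.isSelfAdjoint_iff_isSymmetric.1 hSsa) x y
  have key : ∀ x, (⟪x, T x⟫_ℂ).re = ‖S x‖ ^ 2 := by
    intro x
    rw [← hSS, show (S * S) x = S (S x) from rfl, ← sym, inner_self_eq_norm_sq_to_K]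
    norm_cast
  unfold posTrace
  generalize (exists_hilbertBasis ℂ H).choose_spec.choose = c
  simp only [key]
  simp_rw [fun i => (c.tsum_enorm_inner_sq (S (b i))).symm,
    fun i => (b.tsum_enorm_inner_sq (S (c i))).symm]
  rw [ENNReal.tsum_comm]
  simp_rw [← sym (c _), norm_inner_symm]

/-- The Schatten `p`-norm `(Tr |A|^p)^(1/p)`, with values in `[0, ∞]`, where `|A| = (A^* A)^(1/2)`
and the powers of `|A|` are those of the continuous functional calculus. -/
def schattenNorm (p : ℝ) (A : H →L[ℂ] H) : ℝ≥0∞ :=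
  posTrace (CFC.abs A ^ p) ^ (1 / p)

variable (H) in
/-- The Schatten class `{A | Tr |A|^p < ∞}`; for `p = 1` these are the trace class operators. -/
def schattenClass (p : ℝ) : Set (H →L[ℂ] H) :=
  {A | posTrace (CFC.abs A ^ p) < ∞}

variable (H) in
/-- The set of states: the positive trace class operators of trace one. -/
def states : Set (H →L[ℂ] H) :=
  {A | A ∈ schattenClass H 1 ∧ A.IsPositive ∧ posTrace A = 1}

/-- The topology of the distance `‖B - A‖_p` on a set `S` of operators: a subset `U` of `S` is open
iff it contains, with each of its points `A`, a ball `{B ∈ S | ‖B - A‖_p < ε}`. -/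
@[reducible]
def schattenTopology (p : ℝ) (S : Set (H →L[ℂ] H)) : TopologicalSpace S where
  IsOpen U := ∀ A ∈ U, ∃ ε : ℝ≥0∞, 0 < ε ∧
    ∀ B : S, schattenNorm p ((B : H →L[ℂ] H) - (A : H →L[ℂ] H)) < ε → B ∈ U
  isOpen_univ := fun _ _ => ⟨1, one_pos, fun _ _ => Set.mem_univ _⟩
  isOpen_inter := fun U V hU hV A hA => by
    obtain ⟨ε, hε, h⟩ := hU A hA.1
    obtain ⟨δ, hδ, h'⟩ := hV A hA.2
    exact ⟨min ε δ, lt_min hε hδ, fun B hB =>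
      ⟨h B (hB.trans_le (min_le_left _ _)), h' B (hB.trans_le (min_le_right _ _))⟩⟩
  isOpen_sUnion := fun s hs A hA => by
    obtain ⟨U, hU, hAU⟩ := hA
    obtain ⟨ε, hε, h⟩ := hs U hU A hAU
    exact ⟨ε, hε, fun B hB => ⟨U, hU, h B hB⟩⟩


end

/-! The trace norm of `A` bounds every partial trace of `K A` with `K` a contraction, and some `K`
gives `K A = |A|`. Choose a finite set `s` of basis vectors carrying almost all of the trace of
`|A₀| = K A₀`. The `p`-norm dominates the operator norm, so if `A` is `p`-close to `A₀`, then `K A`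
also has partial trace near 1 over `s`. As `A` has trace norm at most 1, little is left off `s`, for
any contraction `L` in place of `K` (`sum_re_inner_le_sqrt`). Now let `L (A₀ - A) = |A₀ - A|` and
split the trace: over `s` the operator norm controls it, off `s` both `A₀` and `A` contribute
little. States have trace norm 1, so this estimate compares the topologies one way; `‖·‖_p ≤ ‖·‖₁`
gives the other. -/

section

variable {H : Type*} [NormedAddCommGroup H] [InnerProductSpace ℂ H] [CompleteSpace H]

/-! ### Factorization through contractions -/

/-- If `‖B x‖ ≤ ‖C x‖` for all `x`, then `B` factors through `C` by a contraction. -/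
theorem ContinuousLinearMap.exists_contraction_mul_eq {B C : H →L[ℂ] H}
    (h : ∀ x, ‖B x‖ ≤ ‖C x‖) : ∃ U : H →L[ℂ] H, ‖U‖ ≤ 1 ∧ U * C = B := by
  set R : Submodule ℂ H := (LinearMap.range C.toLinearMap).topologicalClosure with hR
  have : CompleteSpace R := (Submodule.isClosed_topologicalClosure _).completeSpace_coe
  let e : H →ₗ[ℂ] R := C.toLinearMap.codRestrict R
    fun x => Submodule.le_topologicalClosure _ ⟨x, rfl⟩
  have he : DenseRange e := by
    intro y
    rw [closure_subtype]
    refine closure_mono ?_ (show (y : H) ∈ closure (LinearMap.range C.toLinearMap : Set H) from y.2)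
    rintro _ ⟨x, rfl⟩
    exact ⟨e x, ⟨x, rfl⟩, rfl⟩
  have hn : ∀ x, ‖B.toLinearMap x‖ ≤ 1 * ‖e x‖ := fun x => by simpa [e] using h x
  -- The map `C x ↦ B x` extends by continuity to the closure of the range of `C`, and by zero to
  -- its orthogonal complement.
  let V : R →L[ℂ] H := B.toLinearMap.extendOfNorm e
  refine ⟨V ∘L R.orthogonalProjectionOnto, ?_, ?_⟩
  · refine (ContinuousLinearMap.opNorm_comp_le _ _).trans ?_
    exact mul_le_one₀ (LinearMap.opNorm_extendOfNorm_le he zero_le_one hn) (norm_nonneg _)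
      R.orthogonalProjectionOnto_norm_le
  · ext x
    have h1 : R.orthogonalProjectionOnto (C x) = e x :=
      R.orthogonalProjectionOnto_mem_subspace_eq_self (e x)
    change V (R.orthogonalProjectionOnto (C x)) = B x
    rw [h1]
    exact LinearMap.extendOfNorm_eq he ⟨1, hn⟩ x

theorem norm_cfcAbs_apply (A : H →L[ℂ] H) (x : H) : ‖CFC.abs A x‖ = ‖A x‖ := by
  have hsa : ContinuousLinearMap.adjoint (CFC.abs A) = CFC.abs A :=
    (CFC.abs_nonneg A).isSelfAdjoint
  have h : ⟪CFC.abs A x, CFC.abs A x⟫_ℂ = ⟪A x, A x⟫_ℂ := by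
    rw [← ContinuousLinearMap.adjoint_inner_right, hsa]
    change ⟪x, (CFC.abs A * CFC.abs A) x⟫_ℂ = _
    rw [CFC.abs_mul_abs, ContinuousLinearMap.star_eq_adjoint]
    exact ContinuousLinearMap.adjoint_inner_right A x (A x)
  rw [@norm_eq_sqrt_re_inner ℂ, @norm_eq_sqrt_re_inner ℂ, h]

theorem exists_contraction_mul_eq_cfcAbs (A : H →L[ℂ] H) :
    ∃ K : H →L[ℂ] H, ‖K‖ ≤ 1 ∧ K * A = CFC.abs A :=
  ContinuousLinearMap.exists_contraction_mul_eq fun x => (norm_cfcAbs_apply A x).le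

theorem exists_contraction_mul_cfcAbs_eq (A : H →L[ℂ] H) :
    ∃ U : H →L[ℂ] H, ‖U‖ ≤ 1 ∧ U * CFC.abs A = A :=
  ContinuousLinearMap.exists_contraction_mul_eq fun x => (norm_cfcAbs_apply A x).ge

/-! ### Traces as Hilbert–Schmidt sums; contractions and the trace norm -/

theorem inner_apply_eq_norm_sqrt_sq {T : H →L[ℂ] H} (hT : 0 ≤ T) (x : H) :
    (⟪x, T x⟫_ℂ).re = ‖CFC.sqrt T x‖ ^ 2 := by
  have hsa : ContinuousLinearMap.adjoint (CFC.sqrt T) = CFC.sqrt T :=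
    (CFC.sqrt_nonneg T).isSelfAdjoint
  conv_lhs => rw [← CFC.sqrt_mul_sqrt_self T hT]
  change (⟪x, CFC.sqrt T (CFC.sqrt T x)⟫_ℂ).re = _
  rw [← ContinuousLinearMap.adjoint_inner_left, hsa]
  exact inner_self_eq_norm_sq (𝕜 := ℂ) (CFC.sqrt T x)

theorem posTrace_eq_tsum_norm_sqrt_sq {ι : Type*} (b : HilbertBasis ι ℂ H) {T : H →L[ℂ] H}
    (hT : 0 ≤ T) : posTrace T = ∑' i, ENNReal.ofReal (‖CFC.sqrt T (b i)‖ ^ 2) := by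
  rw [posTrace_eq_tsum b ((ContinuousLinearMap.nonneg_iff_isPositive T).1 hT)]
  simp_rw [inner_apply_eq_norm_sqrt_sq hT]

theorem tsum_norm_sq_adjoint {ι : Type*} (b : HilbertBasis ι ℂ H) (S : H →L[ℂ] H) :
    ∑' i, ENNReal.ofReal (‖S (b i)‖ ^ 2) =
      ∑' i, ENNReal.ofReal (‖ContinuousLinearMap.adjoint S (b i)‖ ^ 2) := by
  simp_rw [fun i => (b.tsum_enorm_inner_sq (S (b i))).symm,
    fun i => (b.tsum_enorm_inner_sq (ContinuousLinearMap.adjoint S (b i))).symm]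
  rw [ENNReal.tsum_comm]
  simp_rw [ContinuousLinearMap.adjoint_inner_right, norm_inner_symm]

theorem sum_le_of_tsum_ofReal_le {ι : Type*} {f : ι → ℝ} (hf : ∀ i, 0 ≤ f i) {τ : ℝ} (hτ : 0 ≤ τ)
    (h : ∑' i, ENNReal.ofReal (f i) ≤ ENNReal.ofReal τ) (t : Finset ι) : ∑ i ∈ t, f i ≤ τ := by
  rw [← ENNReal.ofReal_le_ofReal_iff hτ, ENNReal.ofReal_sum_of_nonneg fun i _ => hf i]
  exact (ENNReal.sum_le_tsum t).trans h

/-- The trace norm dominates the partial traces of `K A`, for every contraction `K`. -/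
theorem sum_re_inner_le_of_posTrace_cfcAbs_le {ι : Type*} (b : HilbertBasis ι ℂ H)
    {A K : H →L[ℂ] H} (hK : ‖K‖ ≤ 1) {τ : ℝ} (hτ : 0 ≤ τ)
    (hA : posTrace (CFC.abs A) ≤ ENNReal.ofReal τ) (t : Finset ι) :
    ∑ i ∈ t, (⟪b i, K (A (b i))⟫_ℂ).re ≤ τ := by
  obtain ⟨U, hU, hUA⟩ := exists_contraction_mul_cfcAbs_eq A
  have h0 := CFC.abs_nonneg A
  rw [posTrace_eq_tsum_norm_sqrt_sq b h0] at hA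
  set S := CFC.sqrt (CFC.abs A) with hS
  have hsa : ContinuousLinearMap.adjoint S = S := (CFC.sqrt_nonneg (CFC.abs A)).isSelfAdjoint
  set V := ContinuousLinearMap.adjoint (K * U) with hV
  have hVn : ‖ContinuousLinearMap.adjoint V‖ ≤ 1 := by
    rw [hV, ContinuousLinearMap.adjoint_adjoint]
    exact (norm_mul_le _ _).trans (mul_le_one₀ hK (norm_nonneg _) hU)
  -- With `A = U S²`, the summand is `re ⟪S V bᵢ, S bᵢ⟫`; apply Cauchy–Schwarz and `2ab ≤ a² + b²`.
  have h1 : ∀ i, (⟪b i, K (A (b i))⟫_ℂ).re ≤ (‖(S * V) (b i)‖ ^ 2 + ‖S (b i)‖ ^ 2) / 2 := by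
    intro i
    have e : K (A (b i)) = (K * U) (S (S (b i))) := by
      conv_lhs => rw [← hUA, ← CFC.sqrt_mul_sqrt_self (CFC.abs A) h0]
      rfl
    rw [e, ← ContinuousLinearMap.adjoint_inner_left, ← hV, ← hsa,
      ContinuousLinearMap.adjoint_inner_right, hsa]
    have h2 : (⟪S (V (b i)), S (b i)⟫_ℂ).re ≤ ‖S (V (b i))‖ * ‖S (b i)‖ :=
      (Complex.re_le_norm _).trans (norm_inner_le_norm _ _)
    change _ ≤ (‖S (V (b i))‖ ^ 2 + _) / 2
    nlinarith [sq_nonneg (‖S (V (b i))‖ - ‖S (b i)‖)]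
  have h2 : ∑' i, ENNReal.ofReal (‖(S * V) (b i)‖ ^ 2) ≤ ENNReal.ofReal τ := by
    -- Passing to the adjoint puts the contraction on the left of `S`, where it can be dropped term
    -- by term.
    rw [tsum_norm_sq_adjoint]
    refine le_trans (ENNReal.tsum_le_tsum fun i => ENNReal.ofReal_le_ofReal ?_) hA
    have e : ContinuousLinearMap.adjoint (S * V) (b i)
        = ContinuousLinearMap.adjoint V (S (b i)) := by
      rw [show S * V = S ∘L V from rfl, ContinuousLinearMap.adjoint_comp, hsa]; rfl
    rw [e]
    gcongr
    exact (ContinuousLinearMap.le_opNorm _ _).trans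
      (mul_le_of_le_one_left (norm_nonneg _) hVn)
  have h3 := sum_le_of_tsum_ofReal_le (fun i => sq_nonneg _) hτ h2 t
  have h4 := sum_le_of_tsum_ofReal_le (fun i => sq_nonneg _) hτ hA t
  refine (Finset.sum_le_sum fun i _ => h1 i).trans ?_
  rw [← Finset.sum_div, Finset.sum_add_distrib]
  linarith

/-! ### Operator norm, Schatten norms and trace norm compared -/

theorem norm_le_posTrace {T : H →L[ℂ] H} (hT : 0 ≤ T) : ENNReal.ofReal ‖T‖ ≤ posTrace T := by
  obtain ⟨w, b, -⟩ := exists_hilbertBasis ℂ H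
  rcases eq_or_ne (posTrace T) ∞ with h | h
  · simp [h]
  have hle : ∑' i, ENNReal.ofReal (‖CFC.sqrt T (b i)‖ ^ 2)
      ≤ ENNReal.ofReal (posTrace T).toReal := by
    rw [ENNReal.ofReal_toReal h, posTrace_eq_tsum_norm_sqrt_sq b hT]
  have hsa : ContinuousLinearMap.adjoint (CFC.sqrt T) = CFC.sqrt T :=
    (CFC.sqrt_nonneg T).isSelfAdjoint
  have key : ∀ x, ‖CFC.sqrt T x‖ ^ 2 ≤ (posTrace T).toReal * ‖x‖ ^ 2 := by
    intro x
    rw [← ENNReal.ofReal_le_ofReal_iff (by positivity), ← b.tsum_enorm_inner_sq,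
      ENNReal.ofReal_mul (by positivity)]
    refine le_trans ?_ (mul_le_mul_left hle _)
    rw [← ENNReal.tsum_mul_right]
    refine ENNReal.tsum_le_tsum fun i => ?_
    rw [← ENNReal.ofReal_mul (by positivity), ← mul_pow, ← ContinuousLinearMap.adjoint_inner_left,
      hsa]
    gcongr
    exact norm_inner_le_norm _ _
  rw [← ENNReal.ofReal_toReal h]
  refine ENNReal.ofReal_le_ofReal ?_
  have h1 : ‖T‖ = ‖CFC.sqrt T‖ * ‖CFC.sqrt T‖ := by
    conv_lhs => rw [← CFC.sqrt_mul_sqrt_self T hT]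
    have := CStarRing.norm_star_mul_self (x := CFC.sqrt T)
    rwa [(CFC.sqrt_nonneg T).isSelfAdjoint.star_eq] at this
  have h2 : ‖CFC.sqrt T‖ ≤ √(posTrace T).toReal := by
    refine ContinuousLinearMap.opNorm_le_bound _ (Real.sqrt_nonneg _) fun x => ?_
    refine (sq_le_sq₀ (norm_nonneg _) (by positivity)).1 ?_
    rw [mul_pow, Real.sq_sqrt ENNReal.toReal_nonneg]
    exact key x
  rw [h1, ← Real.mul_self_sqrt (ENNReal.toReal_nonneg (a := posTrace T))]
  gcongr

theorem posTrace_mono {S T : H →L[ℂ] H} (h : S ≤ T) : posTrace S ≤ posTrace T := by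
  refine ENNReal.tsum_le_tsum fun i => ENNReal.ofReal_le_ofReal ?_
  generalize ((exists_hilbertBasis ℂ H).choose_spec.choose i : H) = x
  have := ((ContinuousLinearMap.le_def S T).1 h).re_inner_nonneg_right x
  simpa [inner_sub_right] using this

theorem posTrace_smul {c : ℝ} (hc : 0 ≤ c) (T : H →L[ℂ] H) :
    posTrace (c • T) = ENNReal.ofReal c * posTrace T := by
  unfold posTrace
  rw [← ENNReal.tsum_mul_left]
  refine tsum_congr fun i => ?_
  rw [← ENNReal.ofReal_mul hc]
  congr 1
  generalize ((exists_hilbertBasis ℂ H).choose_spec.choose i : H) = x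
  rw [smul_apply, inner_smul_right_eq_smul]
  simp

theorem schattenNorm_one (A : H →L[ℂ] H) : schattenNorm 1 A = posTrace (CFC.abs A) := by
  rw [schattenNorm, CFC.rpow_one _ (CFC.abs_nonneg A), div_one, ENNReal.rpow_one]

theorem ofReal_norm_le_schattenNorm {p : ℝ} (hp : 0 < p) (A : H →L[ℂ] H) :
    ENNReal.ofReal ‖A‖ ≤ schattenNorm p A := by
  rw [schattenNorm, one_div, ENNReal.le_rpow_inv_iff hp, ENNReal.ofReal_rpow_of_nonneg
    (norm_nonneg _) hp.le]
  have := norm_le_posTrace (T := CFC.abs A ^ p) CFC.rpow_nonneg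
  rwa [CFC.norm_rpow _ hp (CFC.abs_nonneg A), CFC.norm_abs] at this

theorem CFC.rpow_le_norm_rpow_smul {T : H →L[ℂ] H} (hT : 0 ≤ T) {p : ℝ} (hp : 1 < p) :
    T ^ p ≤ (‖T‖ ^ (p - 1)) • T := by
  have hsa := hT.isSelfAdjoint
  rw [CFC.rpow_eq_cfc_real hT]
  conv_rhs => rw [← cfc_const_mul_id (R := ℝ) (‖T‖ ^ (p - 1)) T]
  refine cfc_mono (fun x hx => ?_) (Real.continuous_rpow_const (by linarith)).continuousOn (by fun_prop)
  have hx0 : 0 ≤ x := spectrum_nonneg_of_nonneg hT hx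
  have hxn : x ≤ ‖T‖ := (le_abs_self x).trans ((spectrum.norm_le_norm_mul_of_mem hx).trans
    (mul_le_of_le_one_right (norm_nonneg _) ContinuousLinearMap.norm_id_le))
  rcases hx0.eq_or_lt with rfl | hx1
  · simp [Real.zero_rpow (by linarith : p ≠ 0)]
  calc x ^ p = x ^ (p - 1) * x := by
        rw [← Real.rpow_add_one hx1.ne']; simp
    _ ≤ _ := by gcongr

/-- `‖A‖_p^p ≤ ‖A‖^(p-1) ‖A‖₁ ≤ ‖A‖₁^p`, the operator norm being at most the trace norm. -/
theorem schattenNorm_le_schattenNorm_one {p : ℝ} (hp : 1 < p) (A : H →L[ℂ] H) :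
    schattenNorm p A ≤ schattenNorm 1 A := by
  have hp0 : 0 < p := by linarith
  have hn := ofReal_norm_le_schattenNorm one_pos A
  rw [schattenNorm, one_div, ENNReal.rpow_inv_le_iff hp0]
  calc posTrace (CFC.abs A ^ p) ≤ posTrace ((‖CFC.abs A‖ ^ (p - 1)) • CFC.abs A) :=
        posTrace_mono (CFC.rpow_le_norm_rpow_smul (CFC.abs_nonneg A) hp)
    _ = ENNReal.ofReal ‖A‖ ^ (p - 1) * schattenNorm 1 A := by
        rw [posTrace_smul (by positivity), CFC.norm_abs, schattenNorm_one,
          ENNReal.ofReal_rpow_of_nonneg (norm_nonneg _) (by linarith)]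
    _ ≤ schattenNorm 1 A ^ (p - 1) * schattenNorm 1 A ^ (1 : ℝ) := by
        rw [ENNReal.rpow_one]
        gcongr
    _ = schattenNorm 1 A ^ p := by
        rw [← ENNReal.rpow_add_of_nonneg _ _ (by linarith) zero_le_one]; simp

/-! ### Partial traces off a finite set of basis vectors -/

theorem HilbertBasis.exists_isStarProjection_apply {ι : Type*} (b : HilbertBasis ι ℂ H)
    (s : Finset ι) : ∃ P : H →L[ℂ] H, IsStarProjection P ∧ (∀ i ∈ s, P (b i) = b i) ∧
      ∀ i ∉ s, P (b i) = 0 := by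
  set E : Submodule ℂ H := Submodule.span ℂ (b '' s)
  have : FiniteDimensional ℂ E := FiniteDimensional.span_of_finite ℂ (s.finite_toSet.image b)
  refine ⟨E.starProjection, isStarProjection_starProjection, fun i hi => ?_, fun i hi => ?_⟩
  · exact Submodule.starProjection_eq_self_iff.2 (Submodule.subset_span ⟨i, hi, rfl⟩)
  · rw [Submodule.starProjection_apply_eq_zero_iff]
    rw [Submodule.mem_orthogonal]
    intro u hu
    induction hu using Submodule.span_induction with
    | mem x hx =>
      obtain ⟨j, hj, rfl⟩ := hx
      exact b.orthonormal.2 fun h => hi (h ▸ hj)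
    | zero => simp
    | add x y _ _ hx hy => rw [inner_add_left, hx, hy, add_zero]
    | smul a x _ hx => rw [inner_smul_left, hx, mul_zero]

theorem IsStarProjection.norm_add_sq {P : H →L[ℂ] H} (hP : IsStarProjection P) (x y : H) :
    ‖P x + (y - P y)‖ ^ 2 = ‖P x‖ ^ 2 + ‖y - P y‖ ^ 2 := by
  have hsa : ContinuousLinearMap.adjoint P = P := hP.isSelfAdjoint
  have hid : ∀ z, P (P z) = P z := fun z => congrArg (· z) hP.isIdempotentElem.eq
  have h : ⟪P x, y - P y⟫_ℂ = 0 := by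
    rw [← ContinuousLinearMap.adjoint_inner_right, hsa, map_sub, hid, sub_self, inner_zero_right]
  simpa [sq] using norm_add_sq_eq_norm_sq_add_norm_sq_of_inner_eq_zero (P x) (y - P y) h

/-- The two summands have orthogonal ranges, so Pythagoras applies. -/
theorem IsStarProjection.norm_smul_mul_add_smul_le {P K L : H →L[ℂ] H} (hP : IsStarProjection P)
    (hK : ‖K‖ ≤ 1) (hL : ‖L‖ ≤ 1) {c d : ℝ} (hcd : c ^ 2 + d ^ 2 ≤ 1) :
    ‖(c : ℂ) • (P * K) + (d : ℂ) • ((1 - P) * L)‖ ≤ 1 := by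
  have hPn : ∀ z, ‖P z‖ ^ 2 ≤ ‖z‖ ^ 2 ∧ ‖z - P z‖ ^ 2 ≤ ‖z‖ ^ 2 := by
    intro z
    have := hP.norm_add_sq z z
    rw [add_sub_cancel] at this
    constructor <;> nlinarith [sq_nonneg ‖P z‖, sq_nonneg ‖z - P z‖]
  refine ContinuousLinearMap.opNorm_le_bound _ zero_le_one fun x => ?_
  rw [one_mul]
  refine (sq_le_sq₀ (norm_nonneg _) (norm_nonneg _)).1 ?_
  have e : ((c : ℂ) • (P * K) + (d : ℂ) • ((1 - P) * L)) x =
      P ((c : ℂ) • K x) + ((d : ℂ) • L x - P ((d : ℂ) • L x)) := by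
    rw [map_smul, map_smul, ← smul_sub]; rfl
  have hb : ∀ {M : H →L[ℂ] H}, ‖M‖ ≤ 1 → ∀ r : ℝ, ‖(r : ℂ) • M x‖ ^ 2 ≤ r ^ 2 * ‖x‖ ^ 2 := by
    intro M hM r
    rw [norm_smul, mul_pow, Complex.norm_real, Real.norm_eq_abs, sq_abs]
    gcongr
    exact (M.le_opNorm x).trans (mul_le_of_le_one_left (norm_nonneg _) hM)
  rw [e, hP.norm_add_sq]
  have h1 := (hPn ((c : ℂ) • K x)).1.trans (hb hK c)
  have h2 := (hPn ((d : ℂ) • L x)).2.trans (hb hL d)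
  nlinarith [sq_nonneg ‖x‖]

/-- If `‖A‖₁ ≤ 1` and a partial trace of `K A` over `s`, with `K` a contraction, is at least
`1 - δ`, then every partial trace of `L A` off `s`, with `L` a contraction, is at most `√(2 δ)`. -/
theorem sum_re_inner_le_sqrt {ι : Type*} (b : HilbertBasis ι ℂ H) {A K L : H →L[ℂ] H}
    (hA : posTrace (CFC.abs A) ≤ 1) (hK : ‖K‖ ≤ 1) (hL : ‖L‖ ≤ 1) {s u : Finset ι}
    (hsu : Disjoint s u) {δ : ℝ} (hδ : δ ≤ 1)
    (hs : 1 - δ ≤ ∑ i ∈ s, (⟪b i, K (A (b i))⟫_ℂ).re) :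
    ∑ i ∈ u, (⟪b i, L (A (b i))⟫_ℂ).re ≤ √(2 * δ) := by
  classical
  obtain ⟨P, hP, hPs, hPn⟩ := b.exists_isStarProjection_apply s
  have hsa : ContinuousLinearMap.adjoint P = P := hP.isSelfAdjoint
  set x := ∑ i ∈ s, (⟪b i, K (A (b i))⟫_ℂ).re with hx
  set y := ∑ i ∈ u, (⟪b i, L (A (b i))⟫_ℂ).re with hy
  -- Test `A` against the contraction `c P K + d (1 - P) L`, with `P` the projection onto the span
  -- of `s`: it sees `K` on `s` and `L` on `u`.
  have key : ∀ c d : ℝ, c ^ 2 + d ^ 2 ≤ 1 → c * x + d * y ≤ 1 := by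
    intro c d hcd
    have h := sum_re_inner_le_of_posTrace_cfcAbs_le b
      (hP.norm_smul_mul_add_smul_le hK hL hcd) zero_le_one (by simpa using hA) (s ∪ u)
    rw [Finset.sum_union hsu] at h
    have e : ∀ i z w, (⟪b i, ((c : ℂ) • P z + (d : ℂ) • (w - P w))⟫_ℂ).re =
        c * (⟪P (b i), z⟫_ℂ).re + d * ((⟪b i, w⟫_ℂ).re - (⟪P (b i), w⟫_ℂ).re) := by
      intro i z w
      have hPz : ∀ z, ⟪b i, P z⟫_ℂ = ⟪P (b i), z⟫_ℂ := fun z => by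
        rw [← ContinuousLinearMap.adjoint_inner_left, hsa]
      rw [inner_add_right, inner_smul_right, inner_smul_right, inner_sub_right, hPz, hPz]
      simp
    have h1 : ∀ i, (((c : ℂ) • (P * K) + (d : ℂ) • ((1 - P) * L)) (A (b i))) =
      (c : ℂ) • P (K (A (b i))) + (d : ℂ) • (L (A (b i)) - P (L (A (b i)))) := fun i => rfl
    simp_rw [h1, e] at h
    rw [Finset.sum_congr rfl (g := fun i => c * (⟪b i, K (A (b i))⟫_ℂ).re)
        fun i hi => by rw [hPs i hi]; ring,
      Finset.sum_congr rfl (s₁ := u) (g := fun i => d * (⟪b i, L (A (b i))⟫_ℂ).re)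
        fun i hi => by rw [hPn i (Finset.disjoint_right.1 hsu hi)]; simp,
      ← Finset.mul_sum, ← Finset.mul_sum] at h
    exact h
  have hxy : x ^ 2 + y ^ 2 ≤ 1 := by
    by_contra! hlt
    set r := √(x ^ 2 + y ^ 2) with hr
    have hr2 : r ^ 2 = x ^ 2 + y ^ 2 := Real.sq_sqrt (by positivity)
    have hr1 : 1 < r := by
      rw [hr, Real.lt_sqrt zero_le_one]; simpa using hlt
    -- The unit vector along `(x, y)` is the optimal `(c, d)`.
    have := key (x / r) (y / r) (by
      rw [div_pow, div_pow, ← add_div, hr2, div_self (by positivity)])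
    have h2 : x / r * x + y / r * y = r := by
      field_simp; linarith
    linarith
  refine Real.le_sqrt_of_sq_le ?_
  -- Since `x ≥ 1 - δ ≥ 0`, `y² ≤ 1 - (1 - δ)² ≤ 2δ`.
  nlinarith

/-! ### From operator-norm or `p`-norm closeness to trace-norm closeness -/

/-- Near an operator of trace norm one, the operator norm controls the trace norm on the operators
of trace norm at most one. -/
theorem exists_posTrace_cfcAbs_sub_le {A₀ : H →L[ℂ] H} (h₀ : posTrace (CFC.abs A₀) = 1)
    {ε : ℝ} (hε : 0 < ε) : ∃ η > 0, ∀ A : H →L[ℂ] H, posTrace (CFC.abs A) ≤ 1 →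
      ‖A₀ - A‖ < η → posTrace (CFC.abs (A₀ - A)) ≤ ENNReal.ofReal ε := by
  classical
  obtain ⟨w, b, -⟩ := exists_hilbertBasis ℂ H
  obtain ⟨δ, hδ0, hδ1, hδ⟩ : ∃ δ : ℝ, 0 < δ ∧ δ ≤ 1 ∧ 2 * √(2 * δ) + δ ≤ ε := by
    refine ⟨min 1 (min (ε / 2) (ε ^ 2 / 32)), by positivity, min_le_left _ _, ?_⟩
    set δ := min 1 (min (ε / 2) (ε ^ 2 / 32))
    have h1 : δ ≤ ε / 2 := (min_le_right _ _).trans (min_le_left _ _)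
    have h2 : δ ≤ ε ^ 2 / 32 := (min_le_right _ _).trans (min_le_right _ _)
    have h3 : √(2 * δ) ≤ ε / 4 := Real.sqrt_le_iff.2 ⟨by positivity, by nlinarith⟩
    linarith
  obtain ⟨K, hK, hKA⟩ := exists_contraction_mul_eq_cfcAbs A₀
  have habs : ∀ {B L : H →L[ℂ] H}, L * B = CFC.abs B → ∀ i,
      (⟪b i, L (B (b i))⟫_ℂ).re = ‖CFC.sqrt (CFC.abs B) (b i)‖ ^ 2 := by
    intro B L h i
    rw [← inner_apply_eq_norm_sqrt_sq (CFC.abs_nonneg B), ← h]; rfl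
  -- Only `δ / 2` is lost here; the other half pays for replacing `A₀` by `A`.
  obtain ⟨s, hs⟩ : ∃ s : Finset w, 1 - δ / 2 < ∑ i ∈ s, (⟪b i, K (A₀ (b i))⟫_ℂ).re := by
    have hlt : ENNReal.ofReal (1 - δ / 2) <
        ∑' i, ENNReal.ofReal (‖CFC.sqrt (CFC.abs A₀) (b i)‖ ^ 2) := by
      rw [← posTrace_eq_tsum_norm_sqrt_sq b (CFC.abs_nonneg A₀), h₀, ENNReal.ofReal_lt_one]
      linarith
    rw [ENNReal.tsum_eq_iSup_sum, lt_iSup_iff] at hlt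
    obtain ⟨s, hs⟩ := hlt
    refine ⟨s, ?_⟩
    rw [← ENNReal.ofReal_sum_of_nonneg fun i _ => sq_nonneg _] at hs
    simp_rw [habs hKA]
    exact (ENNReal.ofReal_lt_ofReal_iff_of_nonneg (by linarith)).1 hs
  have hdiff : ∀ {A L : H →L[ℂ] H}, ‖L‖ ≤ 1 → ∀ t ⊆ s,
      ∑ i ∈ t, (⟪b i, L ((A₀ - A) (b i))⟫_ℂ).re ≤ s.card * ‖A₀ - A‖ := by
    intro A L hL t ht
    refine (Finset.sum_le_card_nsmul t _ ‖A₀ - A‖ fun i _ => ?_).trans ?_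
    · refine (Complex.re_le_norm _).trans ((norm_inner_le_norm _ _).trans ?_)
      rw [b.orthonormal.1 i, one_mul]
      refine (L.le_opNorm _).trans ((mul_le_of_le_one_left (norm_nonneg _) hL).trans ?_)
      simpa [b.orthonormal.1 i] using (A₀ - A).le_opNorm (b i)
    · rw [nsmul_eq_mul]
      gcongr
  refine ⟨δ / (2 * (s.card + 1)), by positivity, fun A hA hAη => ?_⟩
  have hsmall : s.card * ‖A₀ - A‖ ≤ δ / 2 := by
    rw [lt_div_iff₀ (by positivity)] at hAη
    nlinarith [norm_nonneg (A₀ - A)]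
  have hsA : 1 - δ ≤ ∑ i ∈ s, (⟪b i, K (A (b i))⟫_ℂ).re := by
    have h := hdiff (A := A) hK s subset_rfl
    simp only [sub_apply, map_sub, inner_sub_right, Complex.sub_re,
      Finset.sum_sub_distrib] at h
    linarith
  obtain ⟨L, hL, hLA⟩ := exists_contraction_mul_eq_cfcAbs (A₀ - A)
  rw [posTrace_eq_tsum_norm_sqrt_sq b (CFC.abs_nonneg _), ENNReal.tsum_eq_iSup_sum]
  refine iSup_le fun t => ?_
  rw [← ENNReal.ofReal_sum_of_nonneg fun i _ => sq_nonneg _]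
  refine ENNReal.ofReal_le_ofReal ?_
  simp_rw [← habs hLA]
  rw [← Finset.sum_inter_add_sum_sdiff t s]
  have hdisj : Disjoint s (t \ s) := Finset.disjoint_sdiff
  have h1 := hdiff (A := A) hL (t ∩ s) Finset.inter_subset_right
  have h2 := sum_re_inner_le_sqrt b h₀.le hK hL hdisj hδ1 (by linarith)
  -- The bound is one-sided, so the term `-L A` is treated with the contraction `-L`.
  have h3 := sum_re_inner_le_sqrt b (L := -L) hA hK (by rwa [norm_neg]) hdisj hδ1 hsA
  have h4 : ∑ i ∈ t \ s, (⟪b i, L ((A₀ - A) (b i))⟫_ℂ).re =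
      ∑ i ∈ t \ s, (⟪b i, L (A₀ (b i))⟫_ℂ).re + ∑ i ∈ t \ s, (⟪b i, (-L) (A (b i))⟫_ℂ).re := by
    rw [← Finset.sum_add_distrib]
    refine Finset.sum_congr rfl fun i _ => ?_
    simp [sub_eq_add_neg]
  linarith

/-- Near an operator of trace norm one, the Schatten `p`-norm controls the trace norm on the
operators of trace norm at most one. -/
theorem exists_schattenNorm_one_sub_lt {p : ℝ} (hp : 0 < p) {A₀ : H →L[ℂ] H}
    (h₀ : schattenNorm 1 A₀ = 1) {ε : ℝ≥0∞} (hε : 0 < ε) :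
    ∃ η : ℝ≥0∞, 0 < η ∧ ∀ A : H →L[ℂ] H, schattenNorm 1 A ≤ 1 →
      schattenNorm p (A₀ - A) < η → schattenNorm 1 (A₀ - A) < ε := by
  obtain ⟨r, hr0, hrε⟩ := ENNReal.lt_iff_exists_nnreal_btwn.1 hε
  rw [schattenNorm_one] at h₀
  obtain ⟨η, hη, h⟩ := exists_posTrace_cfcAbs_sub_le h₀
    (show (0 : ℝ) < r by exact_mod_cast hr0)
  refine ⟨ENNReal.ofReal η, ENNReal.ofReal_pos.2 hη, fun A hA hAη => ?_⟩
  rw [schattenNorm_one] at hA ⊢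
  refine (h A hA ?_).trans_lt (by simpa using hrε)
  exact (ENNReal.ofReal_lt_ofReal_iff hη).1 ((ofReal_norm_le_schattenNorm hp _).trans_lt hAη)

theorem schattenNorm_sub_comm (p : ℝ) (A B : H →L[ℂ] H) :
    schattenNorm p (A - B) = schattenNorm p (B - A) := by
  rw [schattenNorm, schattenNorm, ← neg_sub, CFC.abs_neg]

theorem schattenNorm_one_of_mem_states {A : H →L[ℂ] H} (hA : A ∈ states H) :
    schattenNorm 1 A = 1 := by
  rw [schattenNorm_one,
    CFC.abs_of_nonneg A ((ContinuousLinearMap.nonneg_iff_isPositive A).2 hA.2.1), hA.2.2]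

end

open Filter Topology in
theorem corollary1 {H : Type*} [NormedAddCommGroup H] [InnerProductSpace ℂ H] [CompleteSpace H]
    (p : ℝ) (hp : 1 < p) :
    (∀ (A₀ : H →L[ℂ] H) (A : ℕ → H →L[ℂ] H),
      A₀ ∈ schattenClass H 1 → (∀ n, A n ∈ schattenClass H 1) →
      IsStarNormal A₀ →
      schattenNorm 1 A₀ = 1 → (∀ n, schattenNorm 1 (A n) = 1) →
      Tendsto (fun n => schattenNorm p (A₀ - A n)) atTop (𝓝 0) →
      Tendsto (fun n => schattenNorm 1 (A₀ - A n)) atTop (𝓝 0)) ∧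
    schattenTopology 1 (states H) = schattenTopology p (states H) := by
  have hp0 : 0 < p := by linarith
  constructor
  · intro A₀ A _ _ _ h₀ hA hlim
    refine tendsto_order.2 ⟨fun a ha => absurd ha not_lt_zero, fun ε hε => ?_⟩
    obtain ⟨η, hη, h⟩ := exists_schattenNorm_one_sub_lt hp0 h₀ hε
    filter_upwards [(tendsto_order.1 hlim).2 η hη] with n hn
    exact h (A n) (hA n).le hn
  · refine TopologicalSpace.ext_iff.2 fun U => ⟨fun hU A hA => ?_, fun hU A hA => ?_⟩
    · obtain ⟨ε, hε, hb⟩ := hU A hA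
      obtain ⟨η, hη, h⟩ :=
        exists_schattenNorm_one_sub_lt hp0 (schattenNorm_one_of_mem_states A.2) hε
      refine ⟨η, hη, fun B hB => hb B ?_⟩
      rw [schattenNorm_sub_comm] at hB ⊢
      exact h B (schattenNorm_one_of_mem_states B.2).le hB
    · obtain ⟨ε, hε, hb⟩ := hU A hA
      exact ⟨ε, hε, fun B hB => hb B ((schattenNorm_le_schattenNorm_one hp _).trans_lt hB)⟩
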